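/- Let $n$ and $k_1$ be powers of two with $k_1 \mid n$, and let $k_0\ge 1$ be an integer. Signals $Y\in\mathbb{C}^n$ are indexed by $\mathbb{Z}/n\mathbb{Z}$, with Fourier transform $\widehat{Y}_f=\frac1n\sum_t Y_t e^{-2\pi i ft/n}$. A vector $\widehat{Z}\in\mathbb{C}^n$ is called $(k_0,k_1)$-block-sparse if it has non-zero entries in at most $k_0$ of the $n/k_1$ blocks $I_j=\big((j-\tfrac12)k_1,(j+\tfrac12)k_1\big]\cap\mathbb{Z}$ (taken modulo $n$), where $j\in\big(-\tfrac{n}{2k_1},\tfrac{n}{2k_1}\big]\cap\mathbb{Z}$. A (randomized) non-adaptive algorithm draws a random set $A\subseteq\mathbb{Z}/n\mathbb{Z}$ of sampling locations independently of the signal $Y$, observes $(Y_t)_{t\in A}$, and computes an output $\widehat{Y}'\in\mathbb{C}^n$ from these observations and its random seed. Then for every $C>0$ there is a constant $c>0$, depending only on $C$, such that for all such $(n,k_0,k_1)$ the following holds. If a non-adaptive algorithm satisfies, for every signal $Y\in\mathbb{C}^n$, with probability at least $\tfrac12$ over its randomness, $$\|\widehat{Y}-\widehat{Y}'\|_2^2\le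 C\min_{\widehat{Y}^*\text{ is }(k_0,k_1)\text{-block-sparse}}\|\widehat{Y}-\widehat{Y}^*\|_2^2,$$ then its expected number of samples (and hence also its maximal number of samples) is at least $c\,k_0k_1\log\frac{n}{k_0k_1}$; that is, the algorithm takes $\Omega\big(k_0k_1\log\frac{n}{k_0k_1}\big)$ samples. -/

import Mathlib

open MeasureTheory

noncomputable section

namespace BlockSparseFFT

/-- A signal of length `n`, or a vector of Fourier coefficients. Indices are taken modulo `n`. -/
abbrev Signal (n : ℕ) : Type := ZMod n → ℂ

/-- The Fourier transform `X̂ f = (1/n) ∑ t, X t * exp (-2π i f t / n)`; Mathlib's `ZMod.dft` is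
the unnormalised sum. -/
def fourierHat {n : ℕ} [NeZero n] (X : Signal n) : Signal n :=
  fun f => (1 / (n : ℂ)) * ZMod.dft X f

/-- The squared `ℓ₂` norm. -/
def normSq {n : ℕ} [NeZero n] (v : Signal n) : ℝ :=
  ∑ f, ‖v f‖ ^ 2

/-- The integers in `(-m/2, m/2]` (integer division rounds down, so this is right for odd `m`
as well). -/
def centered (m : ℕ) : Finset ℤ :=
  Finset.Ioc ((-(m : ℤ)) / 2) ((m : ℤ) / 2)

/-- The `j`-th interval `((j - 1/2) k₁, (j + 1/2) k₁] ∩ ℤ`. -/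
def interval (k₁ : ℕ) (j : ℤ) : Set ℤ :=
  {f | (2 * j - 1) * (k₁ : ℤ) < 2 * f ∧ 2 * f ≤ (2 * j + 1) * (k₁ : ℤ)}

open Classical in
/-- The indices `j` in `(-n/(2k₁), n/(2k₁)]` of the blocks in which `v` has a non-zero value. -/
def activeBlocks {n : ℕ} (k₁ : ℕ) (v : Signal n) : Finset ℤ :=
  (centered (n / k₁)).filter fun j => ∃ f ∈ interval k₁ j, v (f : ZMod n) ≠ 0

/-- `(k₀, k₁)`-block sparsity of a vector of Fourier coefficients: at most `k₀` of the blocks of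
width `k₁` contain a non-zero value. -/
def IsBlockSparse {n : ℕ} (k₀ k₁ : ℕ) (v : Signal n) : Prop :=
  (activeBlocks k₁ v).card ≤ k₀

/-- The squared `ℓ₂` distance from `v` to the best `(k₀, k₁)`-block sparse approximation. The
infimum is over a non-empty finite union of linear subspaces, so it is a minimum. -/
def bestError {n : ℕ} [NeZero n] (k₀ k₁ : ℕ) (v : Signal n) : ℝ :=
  ⨅ w : {w : Signal n // IsBlockSparse k₀ k₁ w}, normSq (v - w.1)

/-- The signal with all entries outside the set `A` of sampled positions erased. -/
def observe {n : ℕ} (A : Finset (ZMod n)) (Y : Signal n) : Signal n :=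
  fun t => if t ∈ A then Y t else 0

/-- A randomized non-adaptive algorithm with random seed in `Ω`. The set of positions to be
sampled depends on the seed only, never on the signal, and the output (a vector of Fourier
coefficients) is computed from the seed and the sampled entries. -/
structure NonAdaptiveAlgorithm (n : ℕ) (Ω : Type*) [MeasurableSpace Ω] where
  /-- The positions sampled in the time domain. -/
  samples : Ω → Finset (ZMod n)
  /-- The map from the seed and the observed entries to the output. -/
  decode : Ω → Signal n → Signal n
  measurableSet_samples : ∀ t, MeasurableSet {ω | t ∈ samples ω}
  measurable_decode : Measurable fun p : Ω × Signal n => decode p.1 p.2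

namespace NonAdaptiveAlgorithm

variable {n : ℕ} {Ω : Type*} [MeasurableSpace Ω]

/-- The output on the signal `Y` with seed `ω`. -/
def output (alg : NonAdaptiveAlgorithm n Ω) (ω : Ω) (Y : Signal n) : Signal n :=
  alg.decode ω (observe (alg.samples ω) Y)

/-- On every signal `Y`, with probability at least `1/2` over the seed, the output `Ŷ'` satisfies
`‖Ŷ - Ŷ'‖² ≤ C * min ‖Ŷ - Ŷ*‖²` over `(k₀, k₁)`-block sparse `Ŷ*`. -/
def AchievesGuarantee [NeZero n] (alg : NonAdaptiveAlgorithm n Ω) (μ : Measure Ω)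
    (k₀ k₁ : ℕ) (C : ℝ) : Prop :=
  ∀ Y : Signal n,
    (1 / 2 : ENNReal) ≤ μ {ω | normSq (fourierHat Y - alg.output ω Y)
      ≤ C * bestError k₀ k₁ (fourierHat Y)}

/-- The expected number of samples. -/
def expectedSamples (alg : NonAdaptiveAlgorithm n Ω) (μ : Measure Ω) : ℝ :=
  ∫ ω, ((alg.samples ω).card : ℝ) ∂μ

end NonAdaptiveAlgorithm

end BlockSparseFFT

end

/-!
A block-sparse spectrum can be concentrated in time: a band-limited bump of frequency width about
`k₁ / 4` has its energy on about `n / k₁` positions around a centre `τ`. Its product with its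
squared modulus (`envelope`) still fits into one block of frequencies, so the product of the
envelope with a trigonometric polynomial on `k₀` block centres is exactly `(k₀, k₁)`-block sparse.
Non-adaptive samples cannot follow the unknown `τ`: on average over `τ` only a fraction of
about `1 / k₁` of them is useful, and the useful ones must identify one of about `n / (k₀ k₁)`
blocks (and an amplitude) for each of `k₀` positions.

To make the second part quantitative, noise is added: the signal is
`bump * (‖bump‖² * carrier + σ * z)` with `z` of independent entries of density proportional to
`exp (-‖z‖)`, and with `σ` of the order of `√k₀`, the typical size of the carrier.

* The energy of the noise is a small multiple of the energy of the signal, so a successful output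
  is close to the spectrum of the code signal, and by orthogonality of the blocks
  (`hammingDist_le_mul_normSq_sub`, `card_close_words_le`) this leaves only
  `L = (2 √Q) ^ k₀` of the `Q ^ k₀` words, where `Q` is the size of the alphabet.
* A shift of `z` by `v` changes probabilities by a factor of at most `exp (∑ t, ‖v t‖)`
  (`laplaceNoise_shift_le`), and only the part of the shift on the sampled positions is seen.
  Hence with a budget `B` for the `ℓ₁` norm of the observed part of `‖bump‖² * carrier / σ`,
  the total success probability over all words is at most `exp B * L`, up to the words that
  exceed the budget (`AchievesGuarantee.fano`).

Averaged over `τ` and over random phases of the carrier, the observed `ℓ₁` norm is of the order of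
(expected number of samples) `/ k₁`. With `exp B * L ≤ Q ^ k₀ / 4` the expected number of samples
is therefore at least of the order of `k₁ B`, and `B` is of the order of `k₀ log (n / (k₀ k₁))`.
The noise plays the part of the Gaussian channel in arguments by mutual information, and no
entropy is needed.
-/

open MeasureTheory

noncomputable section

namespace BlockSparseFFT

section

/-! ### Noise of Laplace type -/

lemma integrable_norm_pow_mul_exp_neg_norm (m : ℕ) :
    Integrable (fun z : ℂ => ‖z‖ ^ m * Real.exp (-‖z‖)) := by
  have h := (integrable_one_add_norm (E := ℂ) (μ := volume) (r := 3)
    (by simp [Complex.finrank_real_complex]; norm_num)).const_mul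
      (((m + 3).factorial : ℝ) * Real.exp 1)
  refine h.mono' (by fun_prop) (Filter.Eventually.of_forall fun z => ?_)
  have h0 : 0 ≤ ‖z‖ := norm_nonneg z
  have h1 : (1 + ‖z‖) ^ (m + 3) / ((m + 3).factorial : ℝ) ≤ Real.exp (1 + ‖z‖) :=
    Real.pow_div_factorial_le_exp _ (by positivity) _
  rw [Real.norm_of_nonneg (by positivity), Real.rpow_neg (by positivity)]
  have h2 : (1 + ‖z‖) ^ (3 : ℝ) = (1 + ‖z‖) ^ 3 := by norm_cast
  rw [h2, Real.exp_neg, ← div_eq_mul_inv, ← div_eq_mul_inv, div_le_div_iff₀ (by positivity)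
    (by positivity)]
  rw [div_le_iff₀ (by positivity), Real.exp_add] at h1
  calc ‖z‖ ^ m * (1 + ‖z‖) ^ 3 ≤ (1 + ‖z‖) ^ m * (1 + ‖z‖) ^ 3 := by gcongr; linarith
    _ = (1 + ‖z‖) ^ (m + 3) := by ring
    _ ≤ _ := by linarith

/-- The second moment of the probability density proportional to `exp (-‖z‖)` on `ℂ`. -/
def laplaceMoment : ℝ :=
  (∫ z : ℂ, ‖z‖ ^ 2 * Real.exp (-‖z‖)) / ∫ z : ℂ, Real.exp (-‖z‖)

lemma integrable_exp_neg_norm : Integrable (fun z : ℂ => Real.exp (-‖z‖)) := by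
  simpa using integrable_norm_pow_mul_exp_neg_norm 0

lemma integral_exp_neg_norm_pos : 0 < ∫ z : ℂ, Real.exp (-‖z‖) :=
  integral_exp_pos integrable_exp_neg_norm

lemma laplaceMoment_nonneg : 0 ≤ laplaceMoment :=
  div_nonneg (integral_nonneg fun z => by positivity) integral_exp_neg_norm_pos.le

/-- The probability density proportional to `exp (-‖z‖)` on `ℂ`. -/
def laplaceDensity (z : ℂ) : ℝ := Real.exp (-‖z‖) / ∫ z : ℂ, Real.exp (-‖z‖)

lemma laplaceDensity_nonneg (z : ℂ) : 0 ≤ laplaceDensity z :=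
  div_nonneg (Real.exp_nonneg _) integral_exp_neg_norm_pos.le

lemma integrable_laplaceDensity : Integrable laplaceDensity :=
  integrable_exp_neg_norm.div_const _

lemma integral_laplaceDensity : ∫ z, laplaceDensity z = 1 := by
  unfold laplaceDensity
  rw [integral_div, div_self integral_exp_neg_norm_pos.ne']

lemma integrable_sq_mul_laplaceDensity : Integrable fun z => ‖z‖ ^ 2 * laplaceDensity z := by
  simpa [laplaceDensity, mul_div_assoc] using
    (integrable_norm_pow_mul_exp_neg_norm 2).div_const (∫ z : ℂ, Real.exp (-‖z‖))

lemma integral_sq_mul_laplaceDensity : ∫ z, ‖z‖ ^ 2 * laplaceDensity z = laplaceMoment := by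
  simp_rw [laplaceDensity, laplaceMoment, ← mul_div_assoc]
  rw [integral_div]

lemma laplaceDensity_sub_le (y v : ℂ) :
    laplaceDensity (y - v) ≤ Real.exp ‖v‖ * laplaceDensity y := by
  unfold laplaceDensity
  rw [← mul_div_assoc, ← Real.exp_add]
  have := integral_exp_neg_norm_pos
  gcongr
  linarith [norm_sub_norm_le y v]

lemma continuous_laplaceDensity : Continuous laplaceDensity := by
  unfold laplaceDensity; fun_prop

variable {n : ℕ} [NeZero n]

/-- The law of a signal whose entries are independent with density `laplaceDensity`. -/
def laplaceNoise (n : ℕ) [NeZero n] : Measure (Signal n) :=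
  volume.withDensity fun z => ENNReal.ofReal (∏ t, laplaceDensity (z t))

lemma measurable_prod_laplaceDensity :
    Measurable fun z : Signal n => ENNReal.ofReal (∏ t, laplaceDensity (z t)) := by
  have := continuous_laplaceDensity
  exact (Continuous.measurable (by fun_prop)).ennreal_ofReal

lemma lintegral_ofReal_prod {F : ZMod n → ℂ → ℝ} (hF : ∀ s, Integrable (F s))
    (h0 : ∀ s z, 0 ≤ F s z) :
    ∫⁻ z : Signal n, ENNReal.ofReal (∏ s, F s (z s)) = ENNReal.ofReal (∏ s, ∫ z, F s z) := by
  have hint : Integrable fun z : Signal n => ∏ s, F s (z s) := Integrable.fintype_prod hF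
  rw [← ofReal_integral_eq_lintegral_ofReal hint
    (Filter.Eventually.of_forall fun z => Finset.prod_nonneg fun s _ => h0 s _),
    integral_fintype_prod_volume_eq_prod F]

instance : IsProbabilityMeasure (laplaceNoise n) := by
  constructor
  rw [laplaceNoise, withDensity_apply _ MeasurableSet.univ, Measure.restrict_univ,
    lintegral_ofReal_prod (F := fun _ => laplaceDensity) (fun _ => integrable_laplaceDensity)
      fun _ => laplaceDensity_nonneg]
  simp [integral_laplaceDensity]

lemma lintegral_norm_sq_laplaceNoise (t : ZMod n) :
    ∫⁻ z, ENNReal.ofReal (‖z t‖ ^ 2) ∂laplaceNoise n = ENNReal.ofReal laplaceMoment := by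
  classical
  let F : ZMod n → ℂ → ℝ := fun s =>
    if s = t then fun z => ‖z‖ ^ 2 * laplaceDensity z else laplaceDensity
  have hF : ∀ s, Integrable (F s) := by
    intro s
    by_cases h : s = t
    · simpa [F, h] using integrable_sq_mul_laplaceDensity
    · simpa [F, h] using integrable_laplaceDensity
  have hprod : ∀ z : Signal n,
      (∏ s, laplaceDensity (z s)) * ‖z t‖ ^ 2 = ∏ s, F s (z s) := by
    intro z
    rw [← Finset.mul_prod_erase _ _ (Finset.mem_univ t),
      ← Finset.mul_prod_erase _ (fun s => F s (z s)) (Finset.mem_univ t)]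
    have : ∏ s ∈ Finset.univ.erase t, F s (z s)
        = ∏ s ∈ Finset.univ.erase t, laplaceDensity (z s) :=
      Finset.prod_congr rfl fun s hs => by simp [F, Finset.ne_of_mem_erase hs]
    rw [this]
    simp [F]
    ring
  rw [laplaceNoise, lintegral_withDensity_eq_lintegral_mul _ measurable_prod_laplaceDensity
    (by fun_prop)]
  have : ∀ z : Signal n, ((fun z : Signal n => ENNReal.ofReal (∏ t, laplaceDensity (z t))) *
      fun z : Signal n => ENNReal.ofReal (‖z t‖ ^ 2)) z = ENNReal.ofReal (∏ s, F s (z s)) := by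
    intro z
    rw [← hprod, Pi.mul_apply, ENNReal.ofReal_mul
      (Finset.prod_nonneg fun t _ => laplaceDensity_nonneg _)]
  simp_rw [this]
  rw [lintegral_ofReal_prod hF, ← Finset.mul_prod_erase _ _ (Finset.mem_univ t),
    Finset.prod_eq_one]
  · simp [F, integral_sq_mul_laplaceDensity]
  · intro s hs
    simp [F, Finset.ne_of_mem_erase hs, integral_laplaceDensity]
  · intro s z
    have := laplaceDensity_nonneg z
    by_cases h : s = t
    · simp only [F, h, if_true]
      positivity
    · simpa [F, h] using this

/-- Translating the noise by `v` multiplies the probability of an event by at most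
`exp (∑ t, ‖v t‖)`. This takes the place of a bound on the capacity of a channel. -/
lemma laplaceNoise_shift_le (v : Signal n) {S : Set (Signal n)} (hS : MeasurableSet S) :
    laplaceNoise n {z | z + v ∈ S} ≤ ENNReal.ofReal (Real.exp (∑ t, ‖v t‖)) *
      laplaceNoise n S := by
  have hmeas : Measurable fun z : Signal n => z + v := by fun_prop
  have hpre : MeasurableSet {z : Signal n | z + v ∈ S} := hmeas hS
  rw [laplaceNoise, withDensity_apply _ hpre, withDensity_apply _ hS, ← lintegral_indicator hpre,
    ← lintegral_indicator hS, ← lintegral_const_mul _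
      (measurable_prod_laplaceDensity.indicator hS),
    ← lintegral_sub_right_eq_self _ v]
  refine lintegral_mono fun y => ?_
  by_cases hy : y ∈ S
  · have : y - v ∈ {z : Signal n | z + v ∈ S} := by simpa using hy
    rw [Set.indicator_of_mem this, Set.indicator_of_mem hy,
      ← ENNReal.ofReal_mul (Real.exp_nonneg _)]
    refine ENNReal.ofReal_le_ofReal ?_
    rw [Real.exp_sum, ← Finset.prod_mul_distrib]
    exact Finset.prod_le_prod (fun t _ => laplaceDensity_nonneg _) fun t _ =>
      laplaceDensity_sub_le _ _
  · have : y - v ∉ {z : Signal n | z + v ∈ S} := by simpa using hy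
    rw [Set.indicator_of_notMem this]
    exact zero_le

end

section

variable {n : ℕ} [NeZero n]

/-! ### Parseval's identity and modulation on `ZMod n` -/

lemma sum_stdAddChar_mul (m : ZMod n) :
    ∑ t : ZMod n, ZMod.stdAddChar (t * m) = if m = 0 then (n : ℂ) else 0 := by
  rw [AddChar.sum_mulShift _ (ZMod.isPrimitive_stdAddChar n), ZMod.card]
  split_ifs <;> simp

lemma conj_stdAddChar (m : ZMod n) :
    (starRingEnd ℂ) (ZMod.stdAddChar m) = ZMod.stdAddChar (-m) := by
  rw [AddChar.map_neg_eq_conj]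

lemma norm_stdAddChar (m : ZMod n) : ‖ZMod.stdAddChar m‖ = 1 :=
  AddChar.norm_apply _ _

lemma sum_norm_dft_sq (x : Signal n) :
    ∑ f, ‖ZMod.dft x f‖ ^ 2 = n * ∑ t, ‖x t‖ ^ 2 := by
  have hconj : ∀ f, (starRingEnd ℂ) (ZMod.dft x f)
      = ∑ t, ZMod.stdAddChar (t * f) * (starRingEnd ℂ) (x t) := by
    intro f
    simp [ZMod.dft_apply, conj_stdAddChar]
  have key : (∑ f, ZMod.dft x f * (starRingEnd ℂ) (ZMod.dft x f) : ℂ)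
      = n * ∑ t, x t * (starRingEnd ℂ) (x t) := by
    simp_rw [hconj, Finset.mul_sum]
    rw [Finset.sum_comm]
    refine Finset.sum_congr rfl fun t _ => ?_
    have := congrFun (ZMod.dft_dft x) (-t)
    simp only [ZMod.dft_apply (ZMod.dft x), neg_neg, smul_eq_mul] at this
    rw [← mul_assoc, ← this, Finset.sum_mul]
    refine Finset.sum_congr rfl fun f _ => ?_
    rw [mul_neg, neg_neg, mul_comm f t]
    ring
  simp only [Complex.mul_conj'] at key
  exact_mod_cast key

lemma normSq_fourierHat (x : Signal n) :
    normSq (fourierHat x) = (1 / n) * ∑ t, ‖x t‖ ^ 2 := by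
  have hn : (n : ℝ) ≠ 0 := Nat.cast_ne_zero.2 (NeZero.ne n)
  simp only [normSq, fourierHat, norm_mul, mul_pow, ← Finset.mul_sum, sum_norm_dft_sq]
  simp
  field_simp

lemma fourierHat_apply (x : Signal n) (f : ZMod n) :
    fourierHat x f = (1 / (n : ℂ)) * ∑ t, ZMod.stdAddChar (-(t * f)) * x t := by
  simp [fourierHat, ZMod.dft_apply]

lemma fourierHat_mul_sum {κ : Type*} [Fintype κ] (w : Signal n) (c : κ → ℂ) (J : κ → ZMod n)
    (f : ZMod n) :
    fourierHat (fun t => w t * ∑ j, c j * ZMod.stdAddChar (J j * t)) f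
      = ∑ j, c j * fourierHat w (f - J j) := by
  simp_rw [fourierHat_apply, Finset.mul_sum]
  rw [Finset.sum_comm]
  refine Finset.sum_congr rfl fun j _ => Finset.sum_congr rfl fun t _ => ?_
  have : ZMod.stdAddChar (-(t * (f - J j)))
      = ZMod.stdAddChar (-(t * f)) * ZMod.stdAddChar (J j * t) := by
    rw [← AddChar.map_add_eq_mul]
    ring_nf
  rw [this]
  ring

lemma fourierHat_add (x y : Signal n) : fourierHat (x + y) = fourierHat x + fourierHat y := by
  ext f
  simp [fourierHat, mul_add]

lemma normSq_add_le (x y : Signal n) : normSq (x + y) ≤ 2 * (normSq x + normSq y) := by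
  simp only [normSq, ← Finset.sum_add_distrib, Finset.mul_sum]
  refine Finset.sum_le_sum fun f _ => ?_
  have h : ‖(x + y) f‖ ≤ ‖x f‖ + ‖y f‖ := norm_add_le _ _
  nlinarith [sq_nonneg (‖x f‖ - ‖y f‖), norm_nonneg ((x + y) f), norm_nonneg (x f),
    norm_nonneg (y f)]

lemma normSq_nonneg (x : Signal n) : 0 ≤ normSq x :=
  Finset.sum_nonneg fun _ _ => by positivity

lemma normSq_sub_comm (x y : Signal n) : normSq (x - y) = normSq (y - x) := by
  simp [normSq, norm_sub_rev]

lemma bestError_le {k₀ k₁ : ℕ} (v w : Signal n) (hw : IsBlockSparse k₀ k₁ w) :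
    bestError k₀ k₁ v ≤ normSq (v - w) :=
  ciInf_le (f := fun w : {w : Signal n // IsBlockSparse k₀ k₁ w} => normSq (v - w.1))
    ⟨0, by rintro _ ⟨w, rfl⟩; exact normSq_nonneg _⟩ ⟨w, hw⟩

/-! ### A band-limited bump -/

/-- The average of the characters with frequencies in `R`, centred at the time `τ`. -/
def bump (R : Finset (ZMod n)) (τ : ZMod n) : Signal n :=
  fun t => (1 / (R.card : ℂ)) * ∑ a ∈ R, ZMod.stdAddChar (a * (t - τ))

/-- `bump` times its squared modulus. Its frequencies lie in `R + R - R`. -/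
def envelope (R : Finset (ZMod n)) (τ : ZMod n) : Signal n :=
  fun t => bump R τ t * (‖bump R τ t‖ ^ 2 : ℝ)

lemma sum_norm_bump_zero_sq (R : Finset (ZMod n)) (hR : R.Nonempty) :
    ∑ t, ‖bump R 0 t‖ ^ 2 = n / R.card := by
  classical
  have hc : (R.card : ℝ) ≠ 0 := Nat.cast_ne_zero.2 hR.card_pos.ne'
  have h : ∀ t, bump R 0 t
      = (1 / (R.card : ℂ)) * ZMod.dft (fun a => if a ∈ R then (1 : ℂ) else 0) (-t) := by
    intro t
    simp [bump, ZMod.dft_apply]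
  simp only [h, norm_mul, mul_pow, ← Finset.mul_sum]
  rw [Fintype.sum_equiv (Equiv.neg (ZMod n))
    (fun t => ‖ZMod.dft (fun a => if a ∈ R then (1 : ℂ) else 0) (-t)‖ ^ 2)
    (fun t => ‖ZMod.dft (fun a => if a ∈ R then (1 : ℂ) else 0) t‖ ^ 2) (fun t => rfl),
    sum_norm_dft_sq]
  have : ∀ a, ‖(if a ∈ R then (1 : ℂ) else 0)‖ ^ 2 = if a ∈ R then (1 : ℝ) else 0 := by
    intro a; split_ifs <;> simp
  simp only [this, Finset.sum_ite_mem, Finset.univ_inter, Finset.sum_const, nsmul_eq_mul]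
  simp
  field_simp

lemma bump_eq (R : Finset (ZMod n)) (τ t : ZMod n) : bump R τ t = bump R 0 (t - τ) := by
  simp [bump]

lemma sum_norm_bump_sq (R : Finset (ZMod n)) (hR : R.Nonempty) (τ : ZMod n) :
    ∑ t, ‖bump R τ t‖ ^ 2 = n / R.card := by
  rw [← sum_norm_bump_zero_sq R hR]
  exact Fintype.sum_equiv (Equiv.subRight τ) _ _ fun t => by rw [bump_eq]; rfl

lemma sum_center_norm_bump_sq (R : Finset (ZMod n)) (hR : R.Nonempty) (t : ZMod n) :
    ∑ τ, ‖bump R τ t‖ ^ 2 = n / R.card := by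
  rw [← sum_norm_bump_zero_sq R hR]
  exact Fintype.sum_equiv (Equiv.subLeft t) _ _ fun τ => by rw [bump_eq]; rfl

lemma envelope_eq (R : Finset (ZMod n)) (τ t : ZMod n) :
    envelope R τ t = (1 / (R.card : ℂ) ^ 3) *
      ∑ a ∈ R, ∑ b ∈ R, ∑ c ∈ R, ZMod.stdAddChar ((a + b - c) * (t - τ)) := by
  have h : ((‖bump R τ t‖ ^ 2 : ℝ) : ℂ) = bump R τ t * (starRingEnd ℂ) (bump R τ t) := by
    rw [Complex.mul_conj']; push_cast; rfl
  have h3 : ∑ a ∈ R, ∑ b ∈ R, ∑ c ∈ R, ZMod.stdAddChar ((a + b - c) * (t - τ))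
      = (∑ a ∈ R, ZMod.stdAddChar (a * (t - τ))) * ((∑ b ∈ R, ZMod.stdAddChar (b * (t - τ))) *
        ∑ c ∈ R, ZMod.stdAddChar (-(c * (t - τ)))) := by
    rw [Finset.sum_mul]
    refine Finset.sum_congr rfl fun a _ => ?_
    rw [Finset.sum_mul_sum, Finset.mul_sum]
    refine Finset.sum_congr rfl fun b _ => ?_
    rw [Finset.mul_sum]
    refine Finset.sum_congr rfl fun c _ => ?_
    rw [← AddChar.map_add_eq_mul, ← AddChar.map_add_eq_mul]
    ring_nf
  rw [envelope, h, h3, bump]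
  simp only [map_mul, map_sum, conj_stdAddChar, map_div₀, map_one, map_natCast]
  ring

lemma fourierHat_envelope (R : Finset (ZMod n)) (τ f : ZMod n) :
    fourierHat (envelope R τ) f = (1 / (R.card : ℂ) ^ 3) *
      ∑ a ∈ R, ∑ b ∈ R, ∑ c ∈ R,
        if a + b - c = f then ZMod.stdAddChar (-((a + b - c) * τ)) else 0 := by
  have hn : (n : ℂ) ≠ 0 := Nat.cast_ne_zero.2 (NeZero.ne n)
  have key : ∀ m : ZMod n, ∑ t, ZMod.stdAddChar (-(t * f)) * ZMod.stdAddChar (m * (t - τ))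
      = n * if m = f then ZMod.stdAddChar (-(m * τ)) else 0 := by
    intro m
    have : ∀ t : ZMod n, ZMod.stdAddChar (-(t * f)) * ZMod.stdAddChar (m * (t - τ))
        = ZMod.stdAddChar (t * (m - f)) * ZMod.stdAddChar (-(m * τ)) := by
      intro t
      rw [← AddChar.map_add_eq_mul, ← AddChar.map_add_eq_mul]
      ring_nf
    simp_rw [this]
    rw [← Finset.sum_mul, sum_stdAddChar_mul]
    simp only [sub_eq_zero]
    split_ifs <;> simp
  rw [fourierHat_apply]
  simp_rw [envelope_eq]
  calc (1 / (n : ℂ)) * ∑ t, ZMod.stdAddChar (-(t * f)) * ((1 / (R.card : ℂ) ^ 3) *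
      ∑ a ∈ R, ∑ b ∈ R, ∑ c ∈ R, ZMod.stdAddChar ((a + b - c) * (t - τ)))
      = (1 / (R.card : ℂ) ^ 3) * ((1 / (n : ℂ)) * ∑ t, ∑ a ∈ R, ∑ b ∈ R, ∑ c ∈ R,
        ZMod.stdAddChar (-(t * f)) * ZMod.stdAddChar ((a + b - c) * (t - τ))) := by
        simp_rw [← Finset.mul_sum]
        rw [mul_left_comm]
        congr 1
        rw [Finset.mul_sum]
        exact Finset.sum_congr rfl fun t _ => by ring
    _ = _ := by
        congr 1
        rw [Finset.sum_comm, Finset.mul_sum]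
        refine Finset.sum_congr rfl fun a _ => ?_
        rw [Finset.sum_comm, Finset.mul_sum]
        refine Finset.sum_congr rfl fun b _ => ?_
        rw [Finset.sum_comm, Finset.mul_sum]
        refine Finset.sum_congr rfl fun c _ => ?_
        rw [key]
        field_simp

lemma exists_of_fourierHat_envelope_ne_zero {R : Finset (ZMod n)} {τ f : ZMod n}
    (h : fourierHat (envelope R τ) f ≠ 0) : ∃ a ∈ R, ∃ b ∈ R, ∃ c ∈ R, a + b - c = f := by
  contrapose! h
  rw [fourierHat_envelope]
  refine mul_eq_zero_of_right _ (Finset.sum_eq_zero fun a ha => Finset.sum_eq_zero fun b hb =>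
    Finset.sum_eq_zero fun c hc => if_neg (h a ha b hb c hc))

/-- The envelope takes the value `1` at `τ`, so its Fourier coefficients, up to phases, add up
to `1`; on few frequencies this forces large energy. -/
lemma one_le_card_mul_normSq_fourierHat_envelope {R S : Finset (ZMod n)} (hR : R.Nonempty)
    (τ : ZMod n) (hS : ∀ f, fourierHat (envelope R τ) f ≠ 0 → f ∈ S) :
    1 ≤ S.card * normSq (fourierHat (envelope R τ)) := by
  have hc : (R.card : ℂ) ≠ 0 := Nat.cast_ne_zero.2 hR.card_pos.ne'
  have hsum : ∑ f, fourierHat (envelope R τ) f * ZMod.stdAddChar (f * τ) = 1 := by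
    simp_rw [fourierHat_envelope, mul_assoc, ← Finset.mul_sum, Finset.sum_mul]
    rw [Finset.sum_comm]
    have : ∀ a ∈ R, (∑ f : ZMod n, ∑ b ∈ R, ∑ c ∈ R,
        (if a + b - c = f then (ZMod.stdAddChar (-((a + b - c) * τ)) : ℂ) else 0) *
          ZMod.stdAddChar (f * τ)) = (R.card : ℂ) ^ 2 := by
      intro a _
      rw [Finset.sum_comm]
      have : ∀ b ∈ R, (∑ f : ZMod n, ∑ c ∈ R,
          (if a + b - c = f then (ZMod.stdAddChar (-((a + b - c) * τ)) : ℂ) else 0) *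
            ZMod.stdAddChar (f * τ)) = (R.card : ℂ) := by
        intro b _
        rw [Finset.sum_comm]
        simp only [ite_mul, zero_mul, Finset.sum_ite_eq, Finset.mem_univ, if_true]
        simp [← AddChar.map_add_eq_mul]
      rw [Finset.sum_congr rfl this]
      simp
      ring
    rw [Finset.sum_congr rfl this]
    simp
    field_simp
  have h1 : (1 : ℝ) ≤ ∑ f ∈ S, ‖fourierHat (envelope R τ) f‖ := by
    calc (1 : ℝ) = ‖∑ f, fourierHat (envelope R τ) f * ZMod.stdAddChar (f * τ)‖ := by
          rw [hsum]; simp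
      _ ≤ ∑ f, ‖fourierHat (envelope R τ) f‖ := by
          refine (norm_sum_le _ _).trans (le_of_eq ?_)
          simp
      _ = ∑ f ∈ S, ‖fourierHat (envelope R τ) f‖ := by
          symm
          refine Finset.sum_subset (Finset.subset_univ _) fun f _ hf => ?_
          by_contra h
          exact hf (hS f fun h0 => h (by simp [h0]))
  calc (1 : ℝ) ≤ (∑ f ∈ S, ‖fourierHat (envelope R τ) f‖) ^ 2 := by nlinarith
    _ ≤ S.card * ∑ f ∈ S, ‖fourierHat (envelope R τ) f‖ ^ 2 := sq_sum_le_card_mul_sum_sq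
    _ ≤ _ := by
        refine mul_le_mul_of_nonneg_left ?_ (by positivity)
        exact Finset.sum_le_sum_of_subset_of_nonneg (Finset.subset_univ _)
          fun _ _ _ => by positivity

end

section

variable {n : ℕ} [NeZero n]

/-! ### Block structure of the spectrum -/

/-- `u` vanishes outside the block around the frequency `0`. -/
def SupportedInZeroBlock (k₁ : ℕ) (u : Signal n) : Prop :=
  ∀ f, u f ≠ 0 → ∃ m ∈ interval k₁ 0, (m : ZMod n) = f

omit [NeZero n] in
lemma block_index_unique {k₁ N : ℕ} (hk : 0 < k₁) (hn : n = k₁ * N) {m m' j j' : ℤ}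
    (hm : m ∈ interval k₁ 0) (hm' : m' ∈ interval k₁ 0)
    (h : ((m + k₁ * j : ℤ) : ZMod n) = ((m' + k₁ * j' : ℤ) : ZMod n)) :
    (j : ZMod N) = (j' : ZMod N) := by
  simp only [interval, Set.mem_ofPred_eq] at hm hm'
  rw [ZMod.intCast_eq_intCast_iff_dvd_sub, hn] at h
  obtain ⟨z, hz⟩ := h
  push_cast at hz
  have hk' : (0 : ℤ) < k₁ := by exact_mod_cast hk
  have hd : (k₁ : ℤ) ∣ m' - m := ⟨N * z - (j' - j), by linear_combination hz⟩
  have h0 : m' - m = 0 := by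
    refine Int.eq_zero_of_abs_lt_dvd hd ?_
    rw [abs_lt]
    constructor <;> linarith [hm.1, hm.2, hm'.1, hm'.2]
  rw [ZMod.intCast_eq_intCast_iff_dvd_sub]
  refine ⟨z, mul_left_cancel₀ hk'.ne' ?_⟩
  linear_combination hz - h0

/-- The superposition of the copies of `u` moved to the blocks `e j`, with coefficients `c j`. -/
def superposition {κ : Type*} [Fintype κ] (k₁ : ℕ) (u : Signal n) (e : κ → ℕ) (c : κ → ℂ) :
    Signal n :=
  fun f => ∑ j, c j * u (f - ((k₁ * e j : ℕ) : ZMod n))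

omit [NeZero n] in
lemma SupportedInZeroBlock.eq_of_ne_zero {k₁ N : ℕ} (hk : 0 < k₁) (hn : n = k₁ * N)
    {u : Signal n} (hu : SupportedInZeroBlock k₁ u) {j j' : ℕ} (hj : j < N) (hj' : j' < N)
    {f : ZMod n} (h : u (f - ((k₁ * j : ℕ) : ZMod n)) ≠ 0)
    (h' : u (f - ((k₁ * j' : ℕ) : ZMod n)) ≠ 0) : j = j' := by
  obtain ⟨m, hm, hmf⟩ := hu _ h
  obtain ⟨m', hm', hmf'⟩ := hu _ h'
  have := block_index_unique hk hn (j := j) (j' := j') hm hm' (by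
    push_cast at hmf hmf' ⊢
    rw [hmf, hmf']
    ring)
  rw [Int.cast_natCast, Int.cast_natCast, ZMod.natCast_eq_natCast_iff'] at this
  rwa [Nat.mod_eq_of_lt hj, Nat.mod_eq_of_lt hj'] at this

/-- Copies of `u` in different blocks are orthogonal. -/
lemma normSq_superposition {κ : Type*} [Fintype κ] {k₁ N : ℕ} (hk : 0 < k₁) (hn : n = k₁ * N)
    {u : Signal n} (hu : SupportedInZeroBlock k₁ u) {e : κ → ℕ} (he : Function.Injective e)
    (heN : ∀ j, e j < N) (c : κ → ℂ) :
    normSq (superposition k₁ u e c) = (∑ j, ‖c j‖ ^ 2) * normSq u := by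
  have hpt : ∀ f, ‖superposition k₁ u e c f‖ ^ 2
      = ∑ j, ‖c j‖ ^ 2 * ‖u (f - ((k₁ * e j : ℕ) : ZMod n))‖ ^ 2 := by
    intro f
    unfold superposition
    by_cases h : ∃ j, u (f - ((k₁ * e j : ℕ) : ZMod n)) ≠ 0
    · obtain ⟨j, hj⟩ := h
      have h0 : ∀ i, i ≠ j → u (f - ((k₁ * e i : ℕ) : ZMod n)) = 0 := by
        intro i hi
        by_contra hne
        exact hi (he (hu.eq_of_ne_zero hk hn (heN i) (heN j) hne hj))
      rw [Fintype.sum_eq_single j fun i hi => by rw [h0 i hi, mul_zero],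
        Fintype.sum_eq_single j fun i hi => by rw [h0 i hi]; simp]
      rw [norm_mul, mul_pow]
    · push Not at h
      simp only [h, mul_zero, Finset.sum_const_zero, norm_zero]
      simp
  simp only [normSq, hpt]
  rw [Finset.sum_comm, Finset.sum_mul]
  refine Finset.sum_congr rfl fun j _ => ?_
  rw [← Finset.mul_sum]
  congr 1
  exact Fintype.sum_equiv (Equiv.subRight ((k₁ * e j : ℕ) : ZMod n)) _ _ fun f => rfl

lemma centered_intCast_injOn (N : ℕ) :
    Set.InjOn (fun j : ℤ => (j : ZMod N)) (centered N) := by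
  intro i hi j hj hij
  simp only [centered, Finset.coe_Ioc, Set.mem_Ioc] at hi hj
  have hd := (ZMod.intCast_eq_intCast_iff_dvd_sub i j N).1 hij
  have := Int.eq_zero_of_abs_lt_dvd hd (by rw [abs_lt]; constructor <;> omega)
  omega

omit [NeZero n] in
lemma isBlockSparse_superposition {κ : Type*} [Fintype κ] {k₀ k₁ N : ℕ} (hk : 0 < k₁)
    (hn : n = k₁ * N) {u : Signal n} (hu : SupportedInZeroBlock k₁ u) (e : κ → ℕ) (c : κ → ℂ)
    (A : Finset κ) (hA : A.card ≤ k₀) (hc : ∀ j, c j ≠ 0 → j ∈ A) :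
    IsBlockSparse k₀ k₁ (superposition k₁ u e c) := by
  classical
  have hN : n / k₁ = N := by rw [hn, Nat.mul_div_cancel_left _ hk]
  refine le_trans ?_ hA
  refine le_trans ?_ (Finset.card_image_le (s := A) (f := fun i => ((e i : ℤ) : ZMod N)))
  refine Finset.card_le_card_of_injOn (fun j : ℤ => (j : ZMod N)) ?_ ?_
  · intro j hj
    simp only [activeBlocks, Finset.coe_filter, Set.mem_ofPred_eq] at hj
    obtain ⟨-, f, hf, hne⟩ := hj
    obtain ⟨i, -, hi⟩ := Finset.exists_ne_zero_of_sum_ne_zero hne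
    obtain ⟨m, hm, hmf⟩ := hu _ (right_ne_zero_of_mul hi)
    refine Finset.mem_coe.2 (Finset.mem_image.2 ⟨i, hc i (left_ne_zero_of_mul hi), ?_⟩)
    have hf0 : f - k₁ * j ∈ interval k₁ 0 := by
      simp only [interval, Set.mem_ofPred_eq] at hf ⊢
      constructor <;> nlinarith [hf.1, hf.2]
    refine block_index_unique hk hn hm hf0 ?_
    push_cast at hmf ⊢
    rw [hmf]
    ring
  · intro i hi j hj hij
    simp only [activeBlocks, Finset.coe_filter, Set.mem_ofPred_eq, hN] at hi hj
    exact centered_intCast_injOn N hi.1 hj.1 hij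

/-- The `k₁ / 4 + 1` lowest frequencies; their threefold sums and differences fit into one
block. -/
def lowFrequencies (n k₁ : ℕ) : Finset (ZMod n) :=
  (Finset.range (k₁ / 4 + 1)).image fun a : ℕ => (a : ZMod n)

omit [NeZero n] in
lemma card_lowFrequencies {k₁ : ℕ} (hk : 0 < k₁) (hkn : k₁ ≤ n) :
    (lowFrequencies n k₁).card = k₁ / 4 + 1 := by
  rw [lowFrequencies, Finset.card_image_of_injOn, Finset.card_range]
  intro a ha b hb hab
  simp only [Finset.coe_range, Set.mem_Iio] at ha hb
  have := (ZMod.natCast_eq_natCast_iff' a b n).1 hab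
  rwa [Nat.mod_eq_of_lt (by omega), Nat.mod_eq_of_lt (by omega)] at this

omit [NeZero n] in
lemma lowFrequencies_nonempty (k₁ : ℕ) : (lowFrequencies n k₁).Nonempty :=
  (Finset.nonempty_range_iff.2 (Nat.succ_ne_zero _)).image _

lemma supportedInZeroBlock_envelope {k₁ : ℕ} (hk : 0 < k₁) (τ : ZMod n) :
    SupportedInZeroBlock k₁ (fourierHat (envelope (lowFrequencies n k₁) τ)) := by
  intro f hf
  obtain ⟨a, ha, b, hb, c, hc, rfl⟩ := exists_of_fourierHat_envelope_ne_zero hf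
  simp only [lowFrequencies, Finset.mem_image, Finset.mem_range] at ha hb hc
  obtain ⟨a, ha, rfl⟩ := ha
  obtain ⟨b, hb, rfl⟩ := hb
  obtain ⟨c, hc, rfl⟩ := hc
  refine ⟨(a : ℤ) + b - c, ?_, by push_cast; rfl⟩
  simp only [interval, Set.mem_ofPred_eq]
  constructor <;> omega

lemma one_le_mul_normSq_fourierHat_envelope {k₁ : ℕ} (hk : 0 < k₁) (τ : ZMod n) :
    1 ≤ k₁ * normSq (fourierHat (envelope (lowFrequencies n k₁) τ)) := by
  refine (one_le_card_mul_normSq_fourierHat_envelope (lowFrequencies_nonempty k₁) τ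
    (S := (centered k₁).image fun m : ℤ => (m : ZMod n)) fun f hf => ?_).trans ?_
  · obtain ⟨m, hm, rfl⟩ := supportedInZeroBlock_envelope hk τ f hf
    refine Finset.mem_image.2 ⟨m, ?_, rfl⟩
    simp only [interval, Set.mem_ofPred_eq] at hm
    simp only [centered, Finset.mem_Ioc]
    omega
  · refine mul_le_mul_of_nonneg_right ?_ (normSq_nonneg _)
    have : (centered k₁).card = k₁ := by
      simp only [centered, Int.card_Ioc]
      omega
    exact_mod_cast Finset.card_image_le.trans this.le

end

section

/-! ### Hamming balls -/

/-- Weighting a word at distance `d` from `w₀` by `Q ^ (card ι / 2 - d)` turns the count into a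
product over the positions. -/
lemma card_hammingBall_half_le {ι α : Type*} [Fintype ι] [DecidableEq ι] [Fintype α]
    [DecidableEq α] (w₀ : ι → α) :
    ((Finset.univ.filter fun w : ι → α => 2 * hammingDist w₀ w ≤ Fintype.card ι).card : ℝ)
      ≤ (2 * Real.sqrt (Fintype.card α)) ^ Fintype.card ι := by
  rcases isEmpty_or_nonempty ι with hι | ⟨⟨i₀⟩⟩
  · simp
    exact Finset.card_filter_le _ _ |>.trans (by simp)
  set k := Fintype.card ι
  set Q : ℝ := (Fintype.card α : ℝ)
  have hQ : 1 ≤ Q := by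
    have : Nonempty α := ⟨w₀ i₀⟩
    exact Nat.one_le_cast.2 Fintype.card_pos
  have hQ0 : Q ≠ 0 := by positivity
  set s := Real.sqrt Q
  have hs : 1 ≤ s := Real.one_le_sqrt.2 hQ
  have hs2 : s ^ 2 = Q := Real.sq_sqrt (by positivity)
  have hprod : ∀ w : ι → α,
      ∏ i, (if w₀ i ≠ w i then 1 / Q else 1) = (1 / Q) ^ hammingDist w₀ w := by
    intro w
    rw [Finset.prod_ite, Finset.prod_const, Finset.prod_const_one, mul_one]
    rfl
  have hletter : ∀ i, ∑ a : α, (if w₀ i ≠ a then 1 / Q else 1) ≤ 2 := by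
    intro i
    have h : ∀ a : α, (if w₀ i ≠ a then 1 / Q else (1 : ℝ))
        ≤ 1 / Q + if w₀ i = a then 1 else 0 := by
      intro a
      have : 0 ≤ 1 / Q := by positivity
      split_ifs <;> simp_all
    refine (Finset.sum_le_sum fun a _ => h a).trans ?_
    rw [Finset.sum_add_distrib, Finset.sum_const, Finset.sum_ite_eq, if_pos (Finset.mem_univ _),
      Finset.card_univ, nsmul_eq_mul, mul_one_div_cancel hQ0]
    norm_num
  calc ((Finset.univ.filter fun w : ι → α => 2 * hammingDist w₀ w ≤ k).card : ℝ)
      = ∑ w ∈ Finset.univ.filter (fun w : ι → α => 2 * hammingDist w₀ w ≤ k), (1 : ℝ) := by simp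
    _ ≤ ∑ w ∈ Finset.univ.filter (fun w : ι → α => 2 * hammingDist w₀ w ≤ k),
          s ^ k * (1 / Q) ^ hammingDist w₀ w := by
        refine Finset.sum_le_sum fun w hw => ?_
        have hw' := (Finset.mem_filter.1 hw).2
        rw [one_div, inv_pow, ← div_eq_mul_inv, le_div_iff₀ (by positivity), one_mul, ← hs2,
          ← pow_mul]
        exact pow_le_pow_right₀ hs hw'
    _ ≤ ∑ w : ι → α, s ^ k * (1 / Q) ^ hammingDist w₀ w :=
        Finset.sum_le_sum_of_subset_of_nonneg (Finset.filter_subset _ _)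
          fun _ _ _ => by positivity
    _ = s ^ k * ∏ i, ∑ a : α, (if w₀ i ≠ a then 1 / Q else 1) := by
        rw [← Finset.mul_sum, Finset.prod_univ_sum, Fintype.piFinset_univ]
        simp only [hprod]
    _ ≤ s ^ k * ∏ _i : ι, 2 := by
        refine mul_le_mul_of_nonneg_left (Finset.prod_le_prod (fun i _ =>
          Finset.sum_nonneg fun a _ => ?_) fun i _ => hletter i) (by positivity)
        split_ifs <;> positivity
    _ = _ := by
        rw [Finset.prod_const, Finset.card_univ, ← mul_pow, mul_comm]

/-! ### The codebook -/

variable {n k q : ℕ} [NeZero n] [NeZero k]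

/-- A word has a letter at each of `k` positions; the letter holds a choice among the `q` blocks
assigned to that position and an amplitude. The amplitudes keep the alphabet large even
for `q = 1`. -/
abbrev Word (k q : ℕ) : Type := ZMod k → Fin q × Fin 128

/-- The coefficients of the word `w` on the blocks; `φ` selects a phase for each position. -/
def coeff (w : Word k q) (φ : ZMod k) (j : ZMod k × Fin q) : ℂ :=
  if (w j.1).1 = j.2 then ZMod.stdAddChar (-(j.1 * φ)) * (((w j.1).2 : ℕ) + 1 : ℂ) else 0

/-- The trigonometric polynomial of a word, with the block `j` represented by its central
frequency `k₁ * e j`. -/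
def carrier (k₁ : ℕ) (e : ZMod k × Fin q → ℕ) (w : Word k q) (φ : ZMod k) : Signal n :=
  fun t => ∑ j, coeff w φ j * ZMod.stdAddChar (((k₁ * e j : ℕ) : ZMod n) * t)

lemma carrier_eq_dft (k₁ : ℕ) (e : ZMod k × Fin q → ℕ) (w : Word k q) (φ : ZMod k)
    (t : ZMod n) :
    carrier k₁ e w φ t = ZMod.dft (fun i => (((w i).2 : ℕ) + 1 : ℂ) *
      ZMod.stdAddChar (((k₁ * e (i, (w i).1) : ℕ) : ZMod n) * t)) φ := by
  rw [carrier, Fintype.sum_prod_type, ZMod.dft_apply]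
  refine Finset.sum_congr rfl fun i _ => ?_
  simp only [coeff, ite_mul, zero_mul, Finset.sum_ite_eq, Finset.mem_univ, if_true, smul_eq_mul]
  ring

/-- Averaged over the phases, the modulus of the carrier is of the order `√k`. -/
lemma sum_norm_carrier_le (k₁ : ℕ) (e : ZMod k × Fin q → ℕ) (w : Word k q) (t : ZMod n) :
    ∑ φ, ‖(carrier k₁ e w φ : Signal n) t‖ ≤ k * (128 * Real.sqrt k) := by
  have hsq : ∑ φ, ‖(carrier k₁ e w φ : Signal n) t‖ ^ 2 ≤ k * (k * 128 ^ 2) := by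
    simp only [carrier_eq_dft, sum_norm_dft_sq]
    refine mul_le_mul_of_nonneg_left ?_ (by positivity)
    have : ∀ i ∈ (Finset.univ : Finset (ZMod k)), ‖(((w i).2 : ℕ) + 1 : ℂ) *
        ZMod.stdAddChar (((k₁ * e (i, (w i).1) : ℕ) : ZMod n) * t)‖ ^ 2 ≤ (128 : ℝ) ^ 2 := by
      intro i _
      have h1 : ‖(((w i).2 : ℕ) + 1 : ℂ)‖ = ((w i).2 : ℕ) + 1 := by
        exact_mod_cast Complex.norm_natCast (((w i).2 : ℕ) + 1)
      have h2 : (((w i).2 : ℕ) : ℝ) + 1 ≤ 128 := by exact_mod_cast (w i).2.2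
      rw [norm_mul, norm_stdAddChar, mul_one, h1]
      gcongr
    refine (Finset.sum_le_card_nsmul _ _ _ this).trans (le_of_eq ?_)
    rw [Finset.card_univ, ZMod.card, nsmul_eq_mul]
  have hcs := sq_sum_le_card_mul_sum_sq (s := (Finset.univ : Finset (ZMod k)))
    (f := fun φ => ‖(carrier k₁ e w φ : Signal n) t‖)
  rw [Finset.card_univ, ZMod.card] at hcs
  refine abs_le_of_sq_le_sq' ?_ (by positivity) |>.2
  have hk := Real.sq_sqrt (Nat.cast_nonneg (α := ℝ) k)
  calc _ ≤ (k : ℝ) * (k * (k * 128 ^ 2)) :=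
        hcs.trans (mul_le_mul_of_nonneg_left hsq (by positivity))
    _ = _ := by rw [mul_pow, mul_pow, hk]; ring

lemma hammingDist_le_sum_coeff (w w' : Word k q) (φ : ZMod k) :
    (hammingDist w w' : ℝ) ≤ ∑ j, ‖(coeff w φ - coeff w' φ) j‖ ^ 2 := by
  rw [Fintype.sum_prod_type, hammingDist, Finset.card_filter]
  push_cast
  refine Finset.sum_le_sum fun i _ => ?_
  split_ifs with hi
  · refine le_trans ?_ (Finset.single_le_sum (f := fun a =>
      ‖(coeff w φ - coeff w' φ) (i, a)‖ ^ 2) (fun _ _ => by positivity)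
      (Finset.mem_univ (w i).1))
    -- At the block chosen by `w`, the coefficients differ by a non-zero integer times a phase.
    have hint : ∃ z : ℤ, z ≠ 0 ∧ (coeff w φ - coeff w' φ) (i, (w i).1)
        = ZMod.stdAddChar (-(i * φ)) * (z : ℂ) := by
      by_cases h : (w' i).1 = (w i).1
      · refine ⟨((w i).2 : ℕ) - ((w' i).2 : ℕ), fun h0 => hi ?_, ?_⟩
        · exact Prod.ext h.symm (Fin.ext (by omega))
        · simp [coeff, h]
          ring
      · exact ⟨((w i).2 : ℕ) + 1, by omega, by simp [coeff, h]⟩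
    obtain ⟨z, hz, hz'⟩ := hint
    rw [hz', norm_mul, norm_stdAddChar, one_mul, Complex.norm_intCast]
    have : (1 : ℝ) ≤ |(z : ℝ)| := by exact_mod_cast Int.one_le_abs hz
    nlinarith
  · positivity

/-- The signal that encodes the word `w`, concentrated near the time `τ`. -/
def codeSignal (k₁ : ℕ) (e : ZMod k × Fin q → ℕ) (w : Word k q) (φ : ZMod k) (τ : ZMod n) :
    Signal n :=
  fun t => envelope (lowFrequencies n k₁) τ t * carrier k₁ e w φ t

lemma fourierHat_codeSignal (k₁ : ℕ) (e : ZMod k × Fin q → ℕ) (w : Word k q) (φ : ZMod k)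
    (τ : ZMod n) :
    fourierHat (codeSignal k₁ e w φ τ)
      = superposition k₁ (fourierHat (envelope (lowFrequencies n k₁) τ)) e (coeff w φ) := by
  ext f
  exact fourierHat_mul_sum _ _ _ _

lemma isBlockSparse_fourierHat_codeSignal {k₁ N : ℕ} (hk : 0 < k₁) (hn : n = k₁ * N)
    (e : ZMod k × Fin q → ℕ) (w : Word k q) (φ : ZMod k) (τ : ZMod n) :
    IsBlockSparse k k₁ (fourierHat (codeSignal k₁ e w φ τ)) := by
  rw [fourierHat_codeSignal]
  refine isBlockSparse_superposition hk hn (supportedInZeroBlock_envelope hk τ) e _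
    (Finset.univ.image fun i => (i, (w i).1)) (Finset.card_image_le.trans (by simp)) ?_
  rintro ⟨i, a⟩ h
  have : (w i).1 = a := by
    by_contra h0
    exact h (if_neg h0)
  exact Finset.mem_image.2 ⟨i, Finset.mem_univ _, by rw [this]⟩

lemma hammingDist_le_mul_normSq_sub {k₁ N : ℕ} (hk : 0 < k₁) (hn : n = k₁ * N)
    {e : ZMod k × Fin q → ℕ} (he : Function.Injective e) (heN : ∀ j, e j < N)
    (w w' : Word k q) (φ : ZMod k) (τ : ZMod n) :
    (hammingDist w w' : ℝ) ≤ k₁ * normSq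
      (fourierHat (codeSignal k₁ e w φ τ) - fourierHat (codeSignal k₁ e w' φ τ)) := by
  set u := fourierHat (envelope (lowFrequencies n k₁) τ)
  have hsub : fourierHat (codeSignal k₁ e w φ τ) - fourierHat (codeSignal k₁ e w' φ τ)
      = superposition k₁ u e (coeff w φ - coeff w' φ) := by
    rw [fourierHat_codeSignal, fourierHat_codeSignal]
    ext f
    simp only [superposition, Pi.sub_apply, sub_mul, Finset.sum_sub_distrib]
    rfl
  rw [hsub, normSq_superposition hk hn (supportedInZeroBlock_envelope hk τ) he heN,
    mul_left_comm]
  refine (hammingDist_le_sum_coeff w w' φ).trans (le_mul_of_one_le_right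
    (Finset.sum_nonneg fun _ _ => by positivity) (one_le_mul_normSq_fourierHat_envelope hk τ))

/-- A spectrum is close to the spectra of few code signals: any two of their words agree in at
least half of the positions. -/
lemma card_close_words_le {k₁ N : ℕ} (hk : 0 < k₁) (hn : n = k₁ * N)
    {e : ZMod k × Fin q → ℕ} (he : Function.Injective e) (heN : ∀ j, e j < N)
    (φ : ZMod k) (τ : ZMod n) (y : Signal n) :
    ((Finset.univ.filter fun w : Word k q =>
      normSq (fourierHat (codeSignal k₁ e w φ τ) - y) ≤ k / (8 * k₁)).card : ℝ)
      ≤ (2 * Real.sqrt (128 * q)) ^ k := by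
  rcases (Finset.univ.filter fun w : Word k q =>
      normSq (fourierHat (codeSignal k₁ e w φ τ) - y) ≤ k / (8 * k₁)).eq_empty_or_nonempty with
    h | ⟨w₀, hw₀⟩
  · rw [h]
    simp only [Finset.card_empty, Nat.cast_zero]
    positivity
  · have hball := card_hammingBall_half_le w₀
    simp only [Fintype.card_prod, Fintype.card_fin, ZMod.card] at hball
    push_cast at hball
    rw [mul_comm (q : ℝ)] at hball
    refine le_trans ?_ hball
    refine Nat.cast_le.2 (Finset.card_le_card fun w hw => ?_)
    have h0 := (Finset.mem_filter.1 hw₀).2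
    have h1 := (Finset.mem_filter.1 hw).2
    refine Finset.mem_filter.2 ⟨Finset.mem_univ _, ?_⟩
    have hd := hammingDist_le_mul_normSq_sub hk hn he heN w₀ w φ τ
    have hle := normSq_add_le (fourierHat (codeSignal k₁ e w₀ φ τ) - y)
      (y - fourierHat (codeSignal k₁ e w φ τ))
    rw [sub_add_sub_cancel, normSq_sub_comm y] at hle
    have hk' : (0 : ℝ) < k₁ := by exact_mod_cast hk
    have h2 : (hammingDist w₀ w : ℝ) ≤ k₁ * (4 * (k / (8 * k₁))) :=
      hd.trans (mul_le_mul_of_nonneg_left (by linarith) hk'.le)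
    have h3 : k₁ * (4 * (k / (8 * k₁))) = (k : ℝ) / 2 := by field_simp; ring
    rw [h3] at h2
    have : (2 * hammingDist w₀ w : ℝ) ≤ k := by linarith
    exact_mod_cast this

end

section

variable {n : ℕ} [NeZero n]

/-! ### Decoding from noisy samples -/

lemma lintegral_sum_mul_norm_sq (a : ZMod n → ℝ) (ha : ∀ t, 0 ≤ a t) :
    ∫⁻ z, ENNReal.ofReal (∑ t, a t * ‖z t‖ ^ 2) ∂laplaceNoise n
      = ENNReal.ofReal ((∑ t, a t) * laplaceMoment) := by
  have h : ∀ z : Signal n, ENNReal.ofReal (∑ t, a t * ‖z t‖ ^ 2)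
      = ∑ t, ENNReal.ofReal (a t) * ENNReal.ofReal (‖z t‖ ^ 2) := by
    intro z
    rw [ENNReal.ofReal_sum_of_nonneg fun t _ => mul_nonneg (ha t) (by positivity)]
    exact Finset.sum_congr rfl fun t _ => ENNReal.ofReal_mul (ha t)
  simp_rw [h]
  rw [lintegral_finsetSum _ fun t _ => by fun_prop, Finset.sum_mul,
    ENNReal.ofReal_sum_of_nonneg fun t _ => mul_nonneg (ha t) laplaceMoment_nonneg]
  refine Finset.sum_congr rfl fun t _ => ?_
  rw [lintegral_const_mul _ (by fun_prop), lintegral_norm_sq_laplaceNoise,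
    ENNReal.ofReal_mul (ha t)]

lemma laplaceNoise_energy_le (a : ZMod n → ℝ) (ha : ∀ t, 0 ≤ a t) {η : ℝ} (hη : 0 < η)
    (h : 10 * ((∑ t, a t) * laplaceMoment) ≤ η) :
    ENNReal.ofReal (9 / 10) ≤ laplaceNoise n {z | ∑ t, a t * ‖z t‖ ^ 2 ≤ η} := by
  have hmeas : Measurable fun z : Signal n => ∑ t, a t * ‖z t‖ ^ 2 := by fun_prop
  have hS : MeasurableSet {z : Signal n | ∑ t, a t * ‖z t‖ ^ 2 ≤ η} :=
    measurableSet_le hmeas measurable_const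
  have hbad : laplaceNoise n {z | ∑ t, a t * ‖z t‖ ^ 2 ≤ η}ᶜ ≤ ENNReal.ofReal (1 / 10) := by
    calc laplaceNoise n {z | ∑ t, a t * ‖z t‖ ^ 2 ≤ η}ᶜ
        ≤ laplaceNoise n {z | ENNReal.ofReal η ≤ ENNReal.ofReal (∑ t, a t * ‖z t‖ ^ 2)} := by
          refine measure_mono fun z hz => ?_
          simp only [Set.mem_compl_iff, Set.mem_ofPred_eq, not_le] at hz
          exact ENNReal.ofReal_le_ofReal hz.le
      _ ≤ (∫⁻ z, ENNReal.ofReal (∑ t, a t * ‖z t‖ ^ 2) ∂laplaceNoise n) / ENNReal.ofReal η :=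
          meas_ge_le_lintegral_div hmeas.ennreal_ofReal.aemeasurable
            (ENNReal.ofReal_pos.2 hη).ne' ENNReal.ofReal_ne_top
      _ ≤ ENNReal.ofReal (1 / 10) := by
          rw [lintegral_sum_mul_norm_sq a ha, ← ENNReal.ofReal_div_of_pos hη]
          refine ENNReal.ofReal_le_ofReal ?_
          rw [div_le_div_iff₀ hη (by norm_num)]
          linarith
  have htot := prob_add_prob_compl (μ := laplaceNoise n) hS
  have h1 : ENNReal.ofReal (9 / 10) + ENNReal.ofReal (1 / 10) = 1 := by
    rw [← ENNReal.ofReal_add (by norm_num) (by norm_num)]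
    norm_num
  rw [← h1] at htot
  refine (ENNReal.add_le_add_iff_right (a := ENNReal.ofReal (1 / 10)) ENNReal.ofReal_ne_top).1 ?_
  rw [← htot]
  gcongr

variable {Ω : Type*} [MeasurableSpace Ω]

omit [NeZero n] in
lemma NonAdaptiveAlgorithm.measurable_output (alg : NonAdaptiveAlgorithm n Ω)
    {Y : Signal n → Signal n} (hY : Measurable Y) :
    Measurable fun p : Ω × Signal n => alg.output p.1 (Y p.2) := by
  have hobs : Measurable fun p : Ω × Signal n => observe (alg.samples p.1) (Y p.2) := by
    refine measurable_pi_lambda _ fun t => ?_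
    exact Measurable.ite ((alg.measurableSet_samples t).preimage measurable_fst)
      ((measurable_pi_apply t).comp (hY.comp measurable_snd)) measurable_const
  exact alg.measurable_decode.comp (measurable_fst.prodMk hobs)

lemma measurable_normSq : Measurable (normSq : Signal n → ℝ) := by
  unfold normSq
  fun_prop

lemma NonAdaptiveAlgorithm.measurableSet_close (alg : NonAdaptiveAlgorithm n Ω)
    {Y : Signal n → Signal n} (hY : Measurable Y) (x : Signal n) (ρ : ℝ) :
    MeasurableSet {p : Ω × Signal n | normSq (x - alg.output p.1 (Y p.2)) ≤ ρ} :=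
  measurableSet_le (measurable_normSq.comp ((alg.measurable_output hY).const_sub x))
    measurable_const

/-- A signal with block-sparse spectrum survives noise of small energy: with probability at
least `2 / 5` over noise and seed the output is close to its spectrum. -/
lemma NonAdaptiveAlgorithm.AchievesGuarantee.two_fifths_le {alg : NonAdaptiveAlgorithm n Ω}
    {μ : Measure Ω} [IsProbabilityMeasure μ] {k₀ k₁ : ℕ} {C : ℝ} (hC : 0 < C)
    (halg : alg.AchievesGuarantee μ k₀ k₁ C) {x : Signal n}
    (hx : IsBlockSparse k₀ k₁ (fourierHat x)) (h : Signal n) {η : ℝ} (hη : 0 < η)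
    (hnoise : 10 * (((1 / n) * ∑ t, ‖h t‖ ^ 2) * laplaceMoment) ≤ η) :
    ENNReal.ofReal (2 / 5) ≤ ∫⁻ ω, laplaceNoise n
      {z | normSq (fourierHat x - alg.output ω (x + h * z)) ≤ 2 * (1 + C) * η} ∂μ := by
  set D : Set (Ω × Signal n) :=
    {p | normSq (fourierHat x - alg.output p.1 (x + h * p.2)) ≤ 2 * (1 + C) * η}
  have hD : MeasurableSet D :=
    alg.measurableSet_close (Y := fun z => x + h * z) (by fun_prop) _ _
  have hG := laplaceNoise_energy_le (fun t => (1 / (n : ℝ)) * ‖h t‖ ^ 2)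
    (fun t => by positivity) hη (by rwa [← Finset.mul_sum])
  set G : Set (Signal n) := {z | ∑ t, (1 / (n : ℝ)) * ‖h t‖ ^ 2 * ‖z t‖ ^ 2 ≤ η}
  have hGm : MeasurableSet G := measurableSet_le (by fun_prop) measurable_const
  have hgood : ∀ z ∈ G, (1 / 2 : ENNReal) ≤ μ {ω | (ω, z) ∈ D} := by
    intro z hz
    refine (halg (x + h * z)).trans (measure_mono fun ω hω => ?_)
    simp only [Set.mem_ofPred_eq] at hω
    have henergy : normSq (fourierHat (h * z)) ≤ η := by
      refine le_trans (le_of_eq ?_) hz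
      rw [normSq_fourierHat, Finset.mul_sum]
      refine Finset.sum_congr rfl fun t _ => ?_
      rw [Pi.mul_apply, norm_mul, mul_pow, mul_assoc]
    have hbest := bestError_le (fourierHat (x + h * z)) _ hx
    rw [fourierHat_add, add_sub_cancel_left] at hbest
    have h1 : normSq (fourierHat x - fourierHat (x + h * z)) ≤ η := by
      rwa [normSq_sub_comm, fourierHat_add, add_sub_cancel_left]
    have h2 : normSq (fourierHat (x + h * z) - alg.output ω (x + h * z)) ≤ C * η := by
      refine hω.trans (mul_le_mul_of_nonneg_left ?_ hC.le)
      rw [fourierHat_add]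
      exact hbest.trans henergy
    have h3 := normSq_add_le (fourierHat x - fourierHat (x + h * z))
      (fourierHat (x + h * z) - alg.output ω (x + h * z))
    rw [sub_add_sub_cancel] at h3
    show normSq (fourierHat x - alg.output ω (x + h * z)) ≤ 2 * (1 + C) * η
    linarith
  calc ENNReal.ofReal (2 / 5) ≤ (1 / 2 : ENNReal) * ENNReal.ofReal (9 / 10) := by
        have : (1 / 2 : ENNReal) = ENNReal.ofReal (1 / 2) := by
          rw [ENNReal.ofReal_div_of_pos (by norm_num)]
          simp
        rw [this, ← ENNReal.ofReal_mul (by norm_num)]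
        exact ENNReal.ofReal_le_ofReal (by norm_num)
    _ ≤ (1 / 2 : ENNReal) * laplaceNoise n G := by gcongr
    _ = ∫⁻ _z in G, (1 / 2 : ENNReal) ∂laplaceNoise n := by rw [setLIntegral_const]
    _ ≤ ∫⁻ z in G, μ {ω | (ω, z) ∈ D} ∂laplaceNoise n := setLIntegral_mono' hGm hgood
    _ ≤ ∫⁻ z, μ {ω | (ω, z) ∈ D} ∂laplaceNoise n := setLIntegral_le_lintegral _ _
    _ = (μ.prod (laplaceNoise n)) D := (Measure.prod_apply_symm hD).symm
    _ = ∫⁻ ω, laplaceNoise n {z | (ω, z) ∈ D} ∂μ := Measure.prod_apply hD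

/-- With `h * x` in place of pure noise `h * z`, the observations shift the noise by the part of
`x` on the sampled positions only, which is cheap unless that part is large. -/
lemma NonAdaptiveAlgorithm.laplaceNoise_close_le (alg : NonAdaptiveAlgorithm n Ω) (ω : Ω)
    (x h y : Signal n) (ρ : ℝ) {B : ℝ} (hB : 0 < B) :
    laplaceNoise n {z | normSq (y - alg.output ω (h * x + h * z)) ≤ ρ}
      ≤ ENNReal.ofReal (Real.exp B) *
          laplaceNoise n {z | normSq (y - alg.output ω (h * z)) ≤ ρ}
        + ENNReal.ofReal ((∑ t ∈ alg.samples ω, ‖x t‖) / B) := by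
  rcases le_or_gt (∑ t ∈ alg.samples ω, ‖x t‖) B with hle | hlt
  · refine le_add_right ?_
    set v : Signal n := fun t => if t ∈ alg.samples ω then x t else 0
    have hobs : ∀ z, alg.output ω (h * x + h * z) = alg.output ω (h * (z + v)) := by
      intro z
      unfold NonAdaptiveAlgorithm.output
      congr 1
      ext t
      by_cases ht : t ∈ alg.samples ω
      · simp [observe, v, ht]
        ring
      · simp [observe, ht]
    have hS : MeasurableSet {z | normSq (y - alg.output ω (h * z)) ≤ ρ} :=
      measurable_prodMk_left (alg.measurableSet_close (Y := fun z => h * z) (by fun_prop) y ρ)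
    have hshift := laplaceNoise_shift_le v hS
    simp only [hobs]
    refine hshift.trans (mul_le_mul_left (ENNReal.ofReal_le_ofReal (Real.exp_le_exp.2 ?_)) _)
    refine le_trans (le_of_eq ?_) hle
    simp only [v, apply_ite norm, norm_zero, Finset.sum_ite_mem, Finset.univ_inter]
  · refine le_add_left (prob_le_one.trans ?_)
    rw [← ENNReal.ofReal_one]
    exact ENNReal.ofReal_le_ofReal ((one_le_div hB).2 hlt.le)

lemma NonAdaptiveAlgorithm.lintegral_sum_samples (alg : NonAdaptiveAlgorithm n Ω)
    (μ : Measure Ω) [IsProbabilityMeasure μ] (c : ZMod n → ℝ) (hc : ∀ t, 0 ≤ c t) :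
    ∫⁻ ω, ENNReal.ofReal (∑ t ∈ alg.samples ω, c t) ∂μ
      = ENNReal.ofReal (∑ t, c t * μ.real {ω | t ∈ alg.samples ω}) := by
  have h : ∀ ω, ENNReal.ofReal (∑ t ∈ alg.samples ω, c t)
      = ∑ t, {ω | t ∈ alg.samples ω}.indicator (fun _ => ENNReal.ofReal (c t)) ω := by
    intro ω
    rw [ENNReal.ofReal_sum_of_nonneg fun t _ => hc t]
    simp [Set.indicator_apply]
  simp_rw [h]
  rw [lintegral_finsetSum _ fun t _ =>
      measurable_const.indicator (alg.measurableSet_samples t),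
    ENNReal.ofReal_sum_of_nonneg fun t _ => mul_nonneg (hc t) measureReal_nonneg]
  refine Finset.sum_congr rfl fun t _ => ?_
  rw [lintegral_indicator_const (alg.measurableSet_samples t), ENNReal.ofReal_mul (hc t),
    ofReal_measureReal]

lemma NonAdaptiveAlgorithm.expectedSamples_eq_sum (alg : NonAdaptiveAlgorithm n Ω)
    (μ : Measure Ω) [IsProbabilityMeasure μ] :
    alg.expectedSamples μ = ∑ t, μ.real {ω | t ∈ alg.samples ω} := by
  have h : ∀ ω, ((alg.samples ω).card : ℝ)
      = ∑ t, {ω | t ∈ alg.samples ω}.indicator (fun _ => (1 : ℝ)) ω := by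
    intro ω
    simp [Set.indicator_apply]
  unfold NonAdaptiveAlgorithm.expectedSamples
  simp_rw [h]
  rw [integral_finsetSum _ fun t _ =>
    (integrable_const _).indicator (alg.measurableSet_samples t)]
  refine Finset.sum_congr rfl fun t _ => ?_
  rw [integral_indicator_const _ (alg.measurableSet_samples t), smul_eq_mul, mul_one]

/-- A Fano-type inequality. If no spectrum is close to more than `L` of the spectra of the code
signals `h * x w`, then decoding requires that the samples see much of the signals `x w`, on
average over `w`. -/
lemma NonAdaptiveAlgorithm.AchievesGuarantee.fano {alg : NonAdaptiveAlgorithm n Ω}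
    {μ : Measure Ω} [IsProbabilityMeasure μ] {k₀ k₁ : ℕ} {C : ℝ} (hC : 0 < C)
    (halg : alg.AchievesGuarantee μ k₀ k₁ C) {W : Type*} [Fintype W] (x : W → Signal n)
    (h : Signal n) (hx : ∀ w, IsBlockSparse k₀ k₁ (fourierHat (h * x w))) {η : ℝ} (hη : 0 < η)
    (hnoise : 10 * (((1 / n) * ∑ t, ‖h t‖ ^ 2) * laplaceMoment) ≤ η) {L : ℝ}
    (hL : ∀ y, ((Finset.univ.filter fun w =>
      normSq (fourierHat (h * x w) - y) ≤ 2 * (1 + C) * η).card : ℝ) ≤ L)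
    {B : ℝ} (hB : 0 < B) :
    2 / 5 * Fintype.card W ≤ Real.exp B * L
      + (∑ w, ∑ t, ‖x w t‖ * μ.real {ω | t ∈ alg.samples ω}) / B := by
  classical
  have hL0 : 0 ≤ L := (Nat.cast_nonneg _).trans (hL 0)
  set ρ := 2 * (1 + C) * η
  let D : Ω → W → Set (Signal n) := fun ω w =>
    {z | normSq (fourierHat (h * x w) - alg.output ω (h * z)) ≤ ρ}
  have hDm : ∀ ω w, MeasurableSet (D ω w) := fun ω w =>
    measurable_prodMk_left (alg.measurableSet_close (Y := fun z => h * z) (by fun_prop) _ ρ)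
  have hpack : ∀ ω, ∑ w, laplaceNoise n (D ω w) ≤ ENNReal.ofReal L := by
    intro ω
    calc ∑ w, laplaceNoise n (D ω w)
        = ∫⁻ z, ∑ w, (D ω w).indicator 1 z ∂laplaceNoise n := by
          rw [lintegral_finsetSum _ fun w _ => measurable_one.indicator (hDm ω w)]
          exact Finset.sum_congr rfl fun w _ => (lintegral_indicator_one (hDm ω w)).symm
      _ ≤ ∫⁻ _z, ENNReal.ofReal L ∂laplaceNoise n := by
          refine lintegral_mono fun z => ?_
          have := hL (alg.output ω (h * z))
          rw [← ENNReal.ofReal_le_ofReal_iff hL0, ENNReal.ofReal_natCast] at this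
          refine le_trans (le_of_eq ?_) this
          simp [Set.indicator_apply, D]
      _ = ENNReal.ofReal L := by simp
  have hmain : ENNReal.ofReal (2 / 5 * Fintype.card W) ≤ ENNReal.ofReal (Real.exp B * L)
      + ENNReal.ofReal ((∑ w, ∑ t, ‖x w t‖ * μ.real {ω | t ∈ alg.samples ω}) / B) := by
    calc ENNReal.ofReal (2 / 5 * Fintype.card W)
        = ∑ _w : W, ENNReal.ofReal (2 / 5) := by
          rw [Finset.sum_const, Finset.card_univ, nsmul_eq_mul, mul_comm,
            ENNReal.ofReal_mul (by positivity), ENNReal.ofReal_natCast]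
      _ ≤ ∑ w, ∫⁻ ω, (ENNReal.ofReal (Real.exp B) * laplaceNoise n (D ω w)
            + ENNReal.ofReal (∑ t ∈ alg.samples ω, ‖x w t‖ / B)) ∂μ := by
          refine Finset.sum_le_sum fun w _ => ?_
          refine (halg.two_fifths_le hC (hx w) h hη hnoise).trans (lintegral_mono fun ω => ?_)
          rw [← Finset.sum_div]
          exact alg.laplaceNoise_close_le ω (x w) h _ ρ hB
      _ = (∫⁻ ω, ENNReal.ofReal (Real.exp B) * ∑ w, laplaceNoise n (D ω w) ∂μ)
            + ∑ w, ∫⁻ ω, ENNReal.ofReal (∑ t ∈ alg.samples ω, ‖x w t‖ / B) ∂μ := by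
          have hm : ∀ w, Measurable fun ω => laplaceNoise n (D ω w) := fun w =>
            measurable_measure_prodMk_left
              (alg.measurableSet_close (Y := fun z => h * z) (by fun_prop) _ ρ)
          simp_rw [Finset.mul_sum]
          rw [lintegral_finsetSum _ fun w _ => (hm w).const_mul _, ← Finset.sum_add_distrib]
          exact Finset.sum_congr rfl fun w _ => lintegral_add_left ((hm w).const_mul _) _
      _ ≤ (∫⁻ _ω, ENNReal.ofReal (Real.exp B) * ENNReal.ofReal L ∂μ)
            + ∑ w, ENNReal.ofReal
              (∑ t, ‖x w t‖ / B * μ.real {ω | t ∈ alg.samples ω}) := by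
          refine add_le_add (lintegral_mono fun ω => by gcongr; exact hpack ω)
            (Finset.sum_le_sum fun w _ => ?_)
          rw [alg.lintegral_sum_samples μ _ fun t => by positivity]
      _ = _ := by
          rw [lintegral_const, measure_univ, mul_one, ← ENNReal.ofReal_mul (Real.exp_nonneg _),
            ← ENNReal.ofReal_sum_of_nonneg fun w _ => Finset.sum_nonneg fun t _ =>
              mul_nonneg (by positivity) measureReal_nonneg]
          congr 2
          rw [Finset.sum_div]
          refine Finset.sum_congr rfl fun w _ => ?_
          rw [Finset.sum_div]
          exact Finset.sum_congr rfl fun t _ => by ring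
  have hnn : 0 ≤ (∑ w, ∑ t, ‖x w t‖ * μ.real {ω | t ∈ alg.samples ω}) / B :=
    div_nonneg (Finset.sum_nonneg fun w _ => Finset.sum_nonneg fun t _ =>
      mul_nonneg (norm_nonneg _) measureReal_nonneg) hB.le
  rw [← ENNReal.ofReal_add (by positivity) hnn] at hmain
  exact (ENNReal.ofReal_le_ofReal_iff (by positivity)).1 hmain

end

section

variable {n : ℕ} [NeZero n] {Ω : Type*} [MeasurableSpace Ω]

/-! ### The sample complexity -/

/-- The noise level, relative to the typical size of the code signals, at which a guarantee with
constant `C` still forces the decoder to find the word approximately. -/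
def noiseLevel (C : ℝ) : ℝ := Real.sqrt (1 / (640 * (1 + C) * (laplaceMoment + 1)))

lemma noiseLevel_pos {C : ℝ} (hC : 0 < C) : 0 < noiseLevel C := by
  have := laplaceMoment_nonneg
  exact Real.sqrt_pos.2 (by positivity)

/-- The Fano-type inequality for the code signals around the time `τ` with the phases `φ`. -/
lemma NonAdaptiveAlgorithm.AchievesGuarantee.fano_codeSignal {alg : NonAdaptiveAlgorithm n Ω}
    {μ : Measure Ω} [IsProbabilityMeasure μ] {k k₁ N q : ℕ} [NeZero k] {C : ℝ} (hC : 0 < C)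
    (halg : alg.AchievesGuarantee μ k k₁ C) (hk₁ : 0 < k₁) (hn : n = k₁ * N)
    {e : ZMod k × Fin q → ℕ} (he : Function.Injective e) (heN : ∀ j, e j < N)
    (φ : ZMod k) (τ : ZMod n) {B : ℝ} (hB : 0 < B) :
    2 / 5 * (128 * q : ℝ) ^ k ≤ Real.exp B * (2 * Real.sqrt (128 * q)) ^ k
      + (∑ w : Word k q, ∑ t, ‖bump (lowFrequencies n k₁) τ t‖ ^ 2
          * ‖(carrier k₁ e w φ : Signal n) t‖ * μ.real {ω | t ∈ alg.samples ω})
        / (noiseLevel C * Real.sqrt k * B) := by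
  have hk : (0 : ℝ) < k := Nat.cast_pos.2 (NeZero.pos k)
  have hk₁' : (0 : ℝ) < k₁ := Nat.cast_pos.2 hk₁
  have hn0 : (0 : ℝ) < n := Nat.cast_pos.2 (NeZero.pos n)
  have hκ := laplaceMoment_nonneg
  set σ := noiseLevel C * Real.sqrt k with hσ
  have hσ0 : 0 < σ := mul_pos (noiseLevel_pos hC) (Real.sqrt_pos.2 hk)
  have hσC : (σ : ℂ) ≠ 0 := Complex.ofReal_ne_zero.2 hσ0.ne'
  set R := lowFrequencies n k₁
  have hR : (k₁ : ℝ) / 4 ≤ R.card := by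
    rw [card_lowFrequencies hk₁ (Nat.le_of_dvd (NeZero.pos n) ⟨N, hn⟩), div_le_iff₀ (by norm_num)]
    exact_mod_cast (by omega : k₁ ≤ (k₁ / 4 + 1) * 4)
  have hR0 : (0 : ℝ) < R.card := lt_of_lt_of_le (by positivity) hR
  -- The noise has the profile of the bump, so that `h * x` is the code signal for a signal `x`
  -- in which the positions far from `τ` carry little information.
  let h : Signal n := fun t => bump R τ t * σ
  let x : Word k q → Signal n := fun w t => (‖bump R τ t‖ ^ 2 : ℝ) * carrier k₁ e w φ t / σ
  have hhx : ∀ w, h * x w = codeSignal k₁ e w φ τ := by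
    intro w
    ext t
    change bump R τ t * σ * ((‖bump R τ t‖ ^ 2 : ℝ) * carrier k₁ e w φ t / σ)
      = bump R τ t * (‖bump R τ t‖ ^ 2 : ℝ) * carrier k₁ e w φ t
    field_simp
  -- The energy of noise for which outputs end up within the radius of `card_close_words_le`.
  set η : ℝ := k / (16 * (1 + C) * k₁) with hη
  have hη0 : 0 < η := by positivity
  have hρ : 2 * (1 + C) * η = k / (8 * k₁) := by
    rw [hη]
    field_simp
    norm_num
  have hnoise : 10 * (((1 / n) * ∑ t, ‖h t‖ ^ 2) * laplaceMoment) ≤ η := by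
    have h1 : ∑ t, ‖h t‖ ^ 2 = n / R.card * σ ^ 2 := by
      simp only [h, norm_mul, mul_pow, ← Finset.sum_mul,
        sum_norm_bump_sq R (lowFrequencies_nonempty k₁), Complex.norm_real, Real.norm_eq_abs,
        sq_abs]
    have h2 : σ ^ 2 = k / (640 * (1 + C) * (laplaceMoment + 1)) := by
      rw [hσ, mul_pow, Real.sq_sqrt hk.le, noiseLevel, Real.sq_sqrt (by positivity)]
      ring
    calc 10 * (((1 / n) * ∑ t, ‖h t‖ ^ 2) * laplaceMoment)
        = 10 * σ ^ 2 * laplaceMoment / R.card := by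
          rw [h1]
          field_simp
      _ ≤ 10 * σ ^ 2 * (laplaceMoment + 1) / (k₁ / 4) := by
          gcongr
          linarith
      _ = η := by
          rw [h2, hη]
          field_simp
          norm_num
  have hfano := halg.fano hC x h
    (fun w => by rw [hhx]; exact isBlockSparse_fourierHat_codeSignal hk₁ hn e w φ τ)
    hη0 hnoise (L := (2 * Real.sqrt (128 * q)) ^ k)
    (fun y => by
      simp only [hhx, hρ]
      exact card_close_words_le hk₁ hn he heN φ τ y) hB
  have hcard : (Fintype.card (Word k q) : ℝ) = (128 * q) ^ k := by
    simp [ZMod.card, mul_comm]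
  rw [hcard] at hfano
  refine hfano.trans (le_of_eq ?_)
  congr 1
  rw [← div_div, Finset.sum_div _ _ σ]
  congr 1
  refine Finset.sum_congr rfl fun w _ => ?_
  rw [Finset.sum_div]
  refine Finset.sum_congr rfl fun t _ => ?_
  simp only [x, norm_mul, norm_div, Complex.norm_real, Real.norm_eq_abs, abs_of_pos hσ0,
    abs_pow, abs_norm]
  ring

/-- Averaging the Fano-type inequality over phases and times. -/
lemma NonAdaptiveAlgorithm.AchievesGuarantee.two_fifths_le_add_expectedSamples
    {alg : NonAdaptiveAlgorithm n Ω}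
    {μ : Measure Ω} [IsProbabilityMeasure μ] {k k₁ N q : ℕ} [NeZero k] {C : ℝ} (hC : 0 < C)
    (halg : alg.AchievesGuarantee μ k k₁ C) (hk₁ : 0 < k₁) (hn : n = k₁ * N)
    (hkq : k * q ≤ N) {B : ℝ} (hB : 0 < B) :
    2 / 5 * (128 * q : ℝ) ^ k ≤ Real.exp B * (2 * Real.sqrt (128 * q)) ^ k
      + (128 * q : ℝ) ^ k * (512 * alg.expectedSamples μ) / (noiseLevel C * k₁ * B) := by
  have hk : (0 : ℝ) < k := Nat.cast_pos.2 (NeZero.pos k)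
  have hk₁' : (0 : ℝ) < k₁ := Nat.cast_pos.2 hk₁
  have hn0 : (0 : ℝ) < n := Nat.cast_pos.2 (NeZero.pos n)
  have hs := noiseLevel_pos hC
  have hsk : 0 < Real.sqrt k := Real.sqrt_pos.2 hk
  set R := lowFrequencies n k₁
  have hR : (k₁ : ℝ) / 4 ≤ R.card := by
    rw [card_lowFrequencies hk₁ (Nat.le_of_dvd (NeZero.pos n) ⟨N, hn⟩), div_le_iff₀ (by norm_num)]
    exact_mod_cast (by omega : k₁ ≤ (k₁ / 4 + 1) * 4)
  have hR0 : (0 : ℝ) < R.card := lt_of_lt_of_le (by positivity) hR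
  let e : ZMod k × Fin q → ℕ := fun j => Fintype.equivFin _ j
  have he : Function.Injective e := Fin.val_injective.comp (Equiv.injective _)
  have heN : ∀ j, e j < N := fun j => (Fin.is_lt _).trans_le (by simpa [ZMod.card] using hkq)
  have hsum := Finset.sum_le_sum fun (φ : ZMod k) (_ : φ ∈ Finset.univ) =>
    Finset.sum_le_sum fun (τ : ZMod n) (_ : τ ∈ Finset.univ) =>
      halg.fano_codeSignal hC hk₁ hn he heN φ τ hB
  simp only [Finset.sum_add_distrib, ← Finset.sum_div] at hsum
  set p : ZMod n → ℝ := fun t => μ.real {ω | t ∈ alg.samples ω}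
  have hp : ∀ t, 0 ≤ p t := fun t => measureReal_nonneg
  have hcost : ∑ φ : ZMod k, ∑ τ : ZMod n, ∑ w : Word k q, ∑ t, ‖bump R τ t‖ ^ 2
      * ‖(carrier k₁ e w φ : Signal n) t‖ * p t
      ≤ (128 * q : ℝ) ^ k * (n / (k₁ / 4) * (k * (128 * Real.sqrt k))
        * alg.expectedSamples μ) := by
    calc ∑ φ : ZMod k, ∑ τ : ZMod n, ∑ w : Word k q, ∑ t, ‖bump R τ t‖ ^ 2
        * ‖(carrier k₁ e w φ : Signal n) t‖ * p t
        = ∑ w : Word k q, ∑ t, (∑ τ, ‖bump R τ t‖ ^ 2)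
            * (∑ φ, ‖(carrier k₁ e w φ : Signal n) t‖) * p t := by
          have h1 : ∀ φ : ZMod k, ∑ τ : ZMod n, ∑ w : Word k q, ∑ t, ‖bump R τ t‖ ^ 2
              * ‖(carrier k₁ e w φ : Signal n) t‖ * p t
              = ∑ w : Word k q, ∑ t, (∑ τ, ‖bump R τ t‖ ^ 2)
                * ‖(carrier k₁ e w φ : Signal n) t‖ * p t := by
            intro φ
            rw [Finset.sum_comm]
            refine Finset.sum_congr rfl fun w _ => ?_
            rw [Finset.sum_comm]
            simp only [Finset.sum_mul]
          simp only [h1]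
          rw [Finset.sum_comm]
          refine Finset.sum_congr rfl fun w _ => ?_
          rw [Finset.sum_comm]
          simp only [Finset.mul_sum, Finset.sum_mul]
      _ ≤ ∑ _w : Word k q, ∑ t, n / (k₁ / 4) * (k * (128 * Real.sqrt k)) * p t := by
          refine Finset.sum_le_sum fun w _ => Finset.sum_le_sum fun t _ => ?_
          rw [sum_center_norm_bump_sq R (lowFrequencies_nonempty k₁)]
          refine mul_le_mul_of_nonneg_right ?_ (hp t)
          gcongr
          exact sum_norm_carrier_le k₁ e w t
      _ = _ := by
          rw [← Finset.mul_sum, ← alg.expectedSamples_eq_sum μ, Finset.sum_const,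
            Finset.card_univ, nsmul_eq_mul]
          simp [ZMod.card, mul_comm]
  simp only [Finset.sum_const, Finset.card_univ, ZMod.card, nsmul_eq_mul] at hsum
  have hfin : (k : ℝ) * (n * (2 / 5 * (128 * q : ℝ) ^ k))
      ≤ k * (n * (Real.exp B * (2 * Real.sqrt (128 * q)) ^ k))
        + (128 * q : ℝ) ^ k * (n / (k₁ / 4) * (k * (128 * Real.sqrt k))
          * alg.expectedSamples μ) / (noiseLevel C * Real.sqrt k * B) := by
    refine hsum.trans (add_le_add le_rfl ?_)
    gcongr
  refine le_of_mul_le_mul_left ?_ (mul_pos hk hn0)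
  refine le_trans (le_of_eq (by ring)) (hfin.trans (le_of_eq ?_))
  field_simp
  ring

/-- The lower bound with an explicit constant. -/
lemma NonAdaptiveAlgorithm.AchievesGuarantee.le_expectedSamples {alg : NonAdaptiveAlgorithm n Ω}
    {μ : Measure Ω} [IsProbabilityMeasure μ] {k₀ k₁ N : ℕ} {C : ℝ} (hC : 0 < C)
    (halg : alg.AchievesGuarantee μ k₀ k₁ C) (hk₁ : 0 < k₁) (hn : n = k₁ * N) (hk₀ : 0 < k₀)
    (hN : k₀ ≤ N) :
    noiseLevel C / 10000 * ((k₀ : ℝ) * k₁ * Real.log (N / k₀)) ≤ alg.expectedSamples μ := by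
  have : NeZero k₀ := ⟨hk₀.ne'⟩
  have hk : (1 : ℝ) ≤ k₀ := Nat.one_le_cast.2 hk₀
  have hk₁' : (0 : ℝ) < k₁ := Nat.cast_pos.2 hk₁
  have hs := noiseLevel_pos hC
  set q := N / k₀
  have hq : 1 ≤ q := (Nat.one_le_div_iff hk₀).2 hN
  have hq' : (1 : ℝ) ≤ q := Nat.one_le_cast.2 hq
  -- A budget that keeps `exp B * L` below a quarter of the number of words; the alphabet
  -- has `128 * q` letters so that the budget is positive for `q = 1` too.
  set B := k₀ / 2 * Real.log (2 * q) with hBdef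
  have hlog : 0 < Real.log (2 * q) := Real.log_pos (by linarith)
  have hB : 0 < B := by positivity
  have hexp : Real.exp B = Real.sqrt (2 * q) ^ k₀ := by
    rw [hBdef, mul_comm, ← mul_div_assoc, mul_div_right_comm, ← Real.log_sqrt (by positivity),
      mul_comm, Real.exp_nat_mul, Real.exp_log (Real.sqrt_pos.2 (by positivity))]
  have hroot : Real.sqrt (2 * q) * (2 * Real.sqrt (128 * q)) = 128 * q / 4 := by
    have : Real.sqrt (2 * q) * Real.sqrt (128 * q) = 16 * q := by
      rw [← Real.sqrt_mul (by positivity), Real.sqrt_eq_iff_mul_self_eq (by positivity)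
        (by positivity)]
      ring
    linear_combination 2 * this
  have hL : Real.exp B * (2 * Real.sqrt (128 * q)) ^ k₀ ≤ (128 * q : ℝ) ^ k₀ / 4 := by
    rw [hexp, ← mul_pow, hroot, div_pow]
    gcongr
    exact le_self_pow₀ (by norm_num) hk₀.ne'
  have hmain := halg.two_fifths_le_add_expectedSamples (q := q) hC hk₁ hn (Nat.mul_div_le N k₀) hB
  have hK : (0 : ℝ) < (128 * q : ℝ) ^ k₀ := by positivity
  have h1 : 3 / 20 ≤ 512 * alg.expectedSamples μ / (noiseLevel C * k₁ * B) := by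
    refine le_of_mul_le_mul_left ?_ hK
    rw [mul_div_assoc] at hmain
    linarith
  rw [le_div_iff₀ (by positivity)] at h1
  have hlogle : Real.log (N / k₀) ≤ Real.log (2 * q) := by
    have hNpos : (0 : ℝ) < N := Nat.cast_pos.2 (hk₀.trans_le hN)
    refine Real.log_le_log (by positivity) ?_
    rw [div_le_iff₀ (by positivity)]
    have h2 : N < k₀ * (q + 1) := Nat.lt_mul_div_succ N hk₀
    have h3 : k₀ * (q + 1) ≤ 2 * q * k₀ := by nlinarith
    exact_mod_cast h2.le.trans h3
  calc noiseLevel C / 10000 * ((k₀ : ℝ) * k₁ * Real.log (N / k₀))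
      ≤ noiseLevel C / 10000 * ((k₀ : ℝ) * k₁ * Real.log (2 * q)) := by gcongr
    _ = noiseLevel C * k₁ * B / 5000 := by rw [hBdef]; ring
    _ ≤ alg.expectedSamples μ := by
        have : 0 < noiseLevel C * k₁ * B := by positivity
        linarith

end

end BlockSparseFFT

end

theorem theorem2 :
    ∀ C : ℝ, 0 < C → ∃ c : ℝ, 0 < c ∧
      ∀ (n k₀ k₁ : ℕ) [NeZero n], (∃ a : ℕ, n = 2 ^ a) → (∃ b : ℕ, k₁ = 2 ^ b) → k₁ ∣ n →
        0 < k₀ →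
        ∀ (Ω : Type*) [MeasurableSpace Ω] (μ : MeasureTheory.Measure Ω)
          [MeasureTheory.IsProbabilityMeasure μ]
          (alg : BlockSparseFFT.NonAdaptiveAlgorithm n Ω),
          alg.AchievesGuarantee μ k₀ k₁ C →
            c * ((k₀ : ℝ) * (k₁ : ℝ) * Real.log ((n : ℝ) / ((k₀ : ℝ) * (k₁ : ℝ))))
              ≤ alg.expectedSamples μ := by
  intro C hC
  have hs := BlockSparseFFT.noiseLevel_pos hC
  refine ⟨BlockSparseFFT.noiseLevel C / 10000, by positivity, ?_⟩
  rintro n k₀ k₁ _ - ⟨b, hb⟩ ⟨N, hN⟩ hk₀ Ω _ μ _ alg halg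
  have hk₁ : 0 < k₁ := hb ▸ by positivity
  have hk₁' : (k₁ : ℝ) ≠ 0 := Nat.cast_ne_zero.2 hk₁.ne'
  have hratio : (n : ℝ) / ((k₀ : ℝ) * (k₁ : ℝ)) = N / k₀ := by
    rw [hN, Nat.cast_mul, mul_comm (k₀ : ℝ), mul_div_mul_left _ _ hk₁']
  rw [hratio]
  rcases le_or_gt k₀ N with hle | hlt
  · exact halg.le_expectedSamples hC hk₁ hN hk₀ hle
  · -- With more than `N` admissible blocks the logarithm is not positive.
    have hlog : Real.log ((N : ℝ) / k₀) ≤ 0 := by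
      refine Real.log_nonpos (by positivity) (div_le_one_of_le₀ ?_ (by positivity))
      exact_mod_cast hlt.le
    have hnonneg : 0 ≤ alg.expectedSamples μ :=
      MeasureTheory.integral_nonneg fun ω => Nat.cast_nonneg _
    exact (mul_nonpos_of_nonneg_of_nonpos (by positivity)
      (mul_nonpos_of_nonneg_of_nonpos (by positivity) hlog)).trans hnonneg
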